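/- A planar convex shape is a nonempty compact convex subset of the Euclidean plane $\mathbb{R}^2$. For a planar convex shape $Q$, let $\mathcal{K}(Q)$ be the family of all planar convex shapes $P$ that can be placed in $Q$ in every orientation, i.e. such that for every rotation $\rho$ about the origin there is a vector $t\in\mathbb{R}^2$ with $\rho P+t\subseteq Q$. The perimeter of a planar convex shape is the length (one-dimensional Hausdorff measure) of its boundary, where a segment of length $L$ is given, as usual, the perimeter $2L$, and a point the perimeter $0$. Disks are closed, and a point counts as a disk of radius $0$. Theorem. Let $Q$ be a planar convex shape. Then among the disks contained in $Q$ there is one of largest radius; and if $D$ is any such largest inscribed disk of $Q$, then every $P\in\mathcal{K}(Q)$ satisfies $\operatorname{peri}(P)\le\operatorname{peri}(D)$. Equality can hold for a shape $P$ that is not a disk: if $Q=[0,1]^2$ is the unit square and $P$ is the Reuleaux triangle of width $1$ (the intersection of the three closed unit disks centred at the vertices of an equilateral triangle of side length $1$), then $P\in\mathcal{K}(Q)$, $P$ is not a disk, and $\operatorname{peri}(P)=\operatorname{peri}(D)$ for the largest inscribed disk $D$ of $Q$. -/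

import Mathlib

/-- The Euclidean plane. -/
abbrev EPlane : Type := EuclideanSpace ℝ (Fin 2)

/-- A planar convex shape: a nonempty compact convex subset of the plane. -/
structure IsConvexShape (K : Set EPlane) : Prop where
  nonempty : K.Nonempty
  isCompact : IsCompact K
  convex : Convex ℝ K

/-- The rotation of the plane about the origin by the angle `θ` (counter-clockwise). -/
noncomputable def rotatePlane (θ : ℝ) (x : EPlane) : EPlane :=
  !₂[Real.cos θ * x 0 - Real.sin θ * x 1, Real.sin θ * x 0 + Real.cos θ * x 1]

/-- `P` can be placed in `Q` in every orientation: every rotated copy of `P` has a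
translate that lies in `Q`. -/
def PlaceableInEveryOrientation (P Q : Set EPlane) : Prop :=
  ∀ θ : ℝ, ∃ t : EPlane, (fun x => rotatePlane θ x + t) '' P ⊆ Q

/-- The family of all convex shapes that can be placed in `Q` in every orientation. -/
def freelyPlaceable (Q : Set EPlane) : Set (Set EPlane) :=
  {P | IsConvexShape P ∧ PlaceableInEveryOrientation P Q}

open Classical in
/-- The perimeter of a planar convex shape: the length (one-dimensional Hausdorff measure)
of its boundary. A shape without interior points is a segment or a point; as usual for
convex sets, its boundary is traversed twice, so that a segment of length `L` has
perimeter `2 * L`. -/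
noncomputable def perimeter (K : Set EPlane) : ENNReal :=
  if (interior K).Nonempty then MeasureTheory.Measure.hausdorffMeasure 1 (frontier K)
  else 2 * MeasureTheory.Measure.hausdorffMeasure 1 K

/-- `D` is a closed disk (a disk of radius zero is a point). -/
def IsDisk (D : Set EPlane) : Prop :=
  ∃ (c : EPlane) (r : ℝ), 0 ≤ r ∧ D = Metric.closedBall c r

/-- `D` is a largest disk contained in `Q`: it is a disk contained in `Q`, and no disk
contained in `Q` has a larger radius. -/
def IsLargestInscribedDisk (D Q : Set EPlane) : Prop :=
  ∃ (c : EPlane) (r : ℝ), 0 ≤ r ∧ D = Metric.closedBall c r ∧ D ⊆ Q ∧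
    ∀ (c' : EPlane) (r' : ℝ), 0 ≤ r' → Metric.closedBall c' r' ⊆ Q → r' ≤ r

/-- The unit square `[0,1] × [0,1]`. -/
def unitSquare : Set EPlane :=
  {x | 0 ≤ x 0 ∧ x 0 ≤ 1 ∧ 0 ≤ x 1 ∧ x 1 ≤ 1}

/-- The Reuleaux triangle of width one: the intersection of the three unit disks centred at
the vertices of an equilateral triangle of side length one. -/
noncomputable def reuleauxTriangle : Set EPlane :=
  Metric.closedBall !₂[0, 0] 1 ∩ Metric.closedBall !₂[1, 0] 1 ∩
    Metric.closedBall !₂[1 / 2, √3 / 2] 1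

/-! Let `c`, `r` be the centre and radius of a largest inscribed disk of `Q`, and write `h` for
support functions. The unit normals `u i` at which the disk touches the boundary have `0` in their
convex hull, since otherwise the disk could be moved off all contacts and enlarged. So there are
weights with `∑ w i • u i = 0` (`exists_balanced_normals`). If a rotated and translated copy of `P`
lies in `Q`, then comparing support functions at the `u i` and taking the weighted sum cancels the
translation. Hence the weighted average of `h` of `P` over the rotated contact normals is at most
`r`, for every rotation (`perimeter_le_of_mem_freelyPlaceable`).

Averaging over all rotations and using Cauchy's formula (perimeter equals the integral of `h`) would
give perimeter at most `2πr`. A discrete form replaces the formula: the equiangular circumscribed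
polygon has perimeter `2 tan(α/2) ∑ h`, and it dominates the boundary length because the
nearest-point map onto `P` is 1-Lipschitz (`hausdorffMeasure_frontier_le_sum`). Inscribed chords
give the matching lower bound for circles.

For the Reuleaux triangle, width at most `1` gives placeability in the square, and three arcs of
angle `π/3` give perimeter at least `π`. The general inequality supplies the other direction. -/

open MeasureTheory Set Filter Topology

/-! ### Unit directions in the plane -/

/-- The unit vector at angle `θ`. -/
noncomputable def unitDir (θ : ℝ) : EPlane := !₂[Real.cos θ, Real.sin θ]

lemma inner_plane (x y : EPlane) : inner ℝ x y = x 0 * y 0 + x 1 * y 1 := by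
  simp [PiLp.inner_apply, Fin.sum_univ_two, mul_comm]

@[simp] lemma unitDir_zero_coord (θ : ℝ) : unitDir θ 0 = Real.cos θ := rfl

@[simp] lemma unitDir_one_coord (θ : ℝ) : unitDir θ 1 = Real.sin θ := rfl

lemma inner_unitDir_unitDir (a b : ℝ) :
    inner ℝ (unitDir a) (unitDir b) = Real.cos (a - b) := by
  rw [inner_plane, Real.cos_sub]; rfl

lemma norm_unitDir (θ : ℝ) : ‖unitDir θ‖ = 1 := by
  have h : ‖unitDir θ‖ ^ 2 = 1 := by
    rw [← real_inner_self_eq_norm_sq, inner_unitDir_unitDir, sub_self, Real.cos_zero]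
  have h0 := norm_nonneg (unitDir θ)
  nlinarith

lemma continuous_unitDir : Continuous unitDir := by
  unfold unitDir
  refine (PiLp.continuous_toLp 2 _).comp (continuous_pi fun i => ?_)
  fin_cases i
  · exact Real.continuous_cos
  · exact Real.continuous_sin

lemma exists_eq_unitDir {v : EPlane} (hv : ‖v‖ = 1) : ∃ θ, v = unitDir θ := by
  have h : v 0 * v 0 + v 1 * v 1 = 1 := by
    rw [← inner_plane, real_inner_self_eq_norm_sq, hv, one_pow]
  have hz : ‖(⟨v 0, v 1⟩ : ℂ)‖ = 1 := by
    rw [Complex.norm_def, Complex.normSq_mk, h, Real.sqrt_one]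
  have hz0 : (⟨v 0, v 1⟩ : ℂ) ≠ 0 := by
    intro h0; rw [h0, norm_zero] at hz; exact zero_ne_one hz
  refine ⟨Complex.arg ⟨v 0, v 1⟩, ?_⟩
  ext i
  fin_cases i
  · simp [Complex.cos_arg hz0, hz]
  · simp [Complex.sin_arg, hz]

lemma inner_rotatePlane_unitDir (θ φ : ℝ) (x : EPlane) :
    inner ℝ (rotatePlane θ x) (unitDir φ) = inner ℝ x (unitDir (φ - θ)) := by
  simp only [inner_plane, rotatePlane, unitDir_zero_coord, unitDir_one_coord, Real.cos_sub,
    Real.sin_sub, Matrix.cons_val_zero, Matrix.cons_val_one]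
  ring

lemma eq_add_unitDir (θ : ℝ) (x : EPlane) :
    x = inner ℝ x (unitDir θ) • unitDir θ +
      inner ℝ x (unitDir (θ + Real.pi / 2)) • unitDir (θ + Real.pi / 2) := by
  have h := Real.cos_sq_add_sin_sq θ
  ext i
  fin_cases i
  · simp [inner_plane, Real.cos_add_pi_div_two, Real.sin_add_pi_div_two]
    linear_combination (-x 0) * h
  · simp [inner_plane, Real.cos_add_pi_div_two, Real.sin_add_pi_div_two]
    linear_combination (-x 1) * h

lemma lipschitzWith_inner_unitDir (θ : ℝ) :
    LipschitzWith 1 fun x : EPlane => inner ℝ x (unitDir θ) := by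
  refine LipschitzWith.of_dist_le_mul fun x y => ?_
  rw [Real.dist_eq, ← inner_sub_left, NNReal.coe_one, one_mul, dist_eq_norm]
  simpa [norm_unitDir] using abs_real_inner_le_norm (x - y) (unitDir θ)

/-! ### Lower bounds for the length of circular arcs -/

/-- The arc of the circle of centre `c` and radius `r` over the angles in `[a, b)`. -/
def circleArc (c : EPlane) (r a b : ℝ) : Set EPlane :=
  (fun θ => c + r • unitDir θ) '' Ico a b

lemma continuous_circle (c : EPlane) (r : ℝ) : Continuous fun θ => c + r • unitDir θ :=
  continuous_const.add (continuous_unitDir.const_smul r)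

/-- The half-open interval keeps angle differences strictly below `2π`, so even a full turn is
covered. -/
lemma injOn_circle (c : EPlane) {r : ℝ} (hr : 0 < r) {a b : ℝ} (hab : b - a ≤ 2 * Real.pi) :
    InjOn (fun θ => c + r • unitDir θ) (Ico a b) := by
  intro s hs t ht hst
  have h1 : unitDir s = unitDir t := by
    have := add_left_cancel hst
    exact smul_right_injective _ hr.ne' this
  have h2 : Real.cos (s - t) = 1 := by
    rw [← inner_unitDir_unitDir, h1, inner_unitDir_unitDir, sub_self, Real.cos_zero]
  have h3 := (Real.cos_eq_one_iff_of_lt_of_lt (by linarith [hs.1, ht.2]) (by linarith [hs.2, ht.1])).1 h2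
  linarith

lemma measurableSet_circleArc (c : EPlane) {r : ℝ} (hr : 0 < r) {a b : ℝ}
    (hab : b - a ≤ 2 * Real.pi) : MeasurableSet (circleArc c r a b) :=
  measurableSet_Ico.image_of_continuousOn_injOn (continuous_circle c r).continuousOn
    (injOn_circle c hr hab)

/-- Orthogonal projection onto the chord direction does not increase length, and by the intermediate
value theorem the projected arc covers an interval as long as the chord. -/
lemma chord_le_hausdorffMeasure_circleArc (c : EPlane) (r : ℝ) {a b : ℝ} (hab : a ≤ b) :
    ENNReal.ofReal (2 * r * Real.sin ((b - a) / 2)) ≤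
      Measure.hausdorffMeasure 1 (circleArc c r a b) := by
  set f : EPlane → ℝ := fun x => inner ℝ x (unitDir ((a + b) / 2 + Real.pi / 2)) with hf
  have hfe : ∀ θ, f (c + r • unitDir θ) = f c + r * Real.sin (θ - (a + b) / 2) := by
    intro θ
    simp only [hf, inner_add_left, real_inner_smul_left, inner_unitDir_unitDir]
    rw [← sub_sub, Real.cos_sub_pi_div_two]
  have hL : LipschitzOnWith 1 f (circleArc c r a b) :=
    (lipschitzWith_inner_unitDir _).lipschitzOnWith
  have h1 := hL.hausdorffMeasure_image_le (d := 1) zero_le_one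
  simp only [ENNReal.coe_one, ENNReal.one_rpow, one_mul] at h1
  refine le_trans ?_ h1
  have hc : ContinuousOn (fun θ => f (c + r • unitDir θ)) (Icc a b) :=
    ((lipschitzWith_inner_unitDir _).continuous.comp (continuous_circle c r)).continuousOn
  have h2 := intermediate_value_Ico hab hc
  have h3 : f '' circleArc c r a b = (fun θ => f (c + r • unitDir θ)) '' Ico a b := by
    rw [circleArc, image_image]
  rw [h3, hausdorffMeasure_real]
  refine le_trans (le_of_eq ?_) (measure_mono h2)
  rw [Real.volume_Ico, hfe, hfe]
  congr 1
  have e1 : b - (a + b) / 2 = (b - a) / 2 := by ring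
  have e2 : a - (a + b) / 2 = -((b - a) / 2) := by ring
  rw [e1, e2, Real.sin_neg]
  ring

lemma tendsto_mul_sin_div (x : ℝ) :
    Tendsto (fun n : ℕ => (n : ℝ) * Real.sin (x / n)) atTop (𝓝 x) := by
  have h' : HasDerivAt (fun t : ℝ => Real.sin (x * t)) x 0 := by
    simpa using ((hasDerivAt_id (0:ℝ)).const_mul x).sin
  have := h'.tendsto_slope_zero_right.comp
    (tendsto_inv_atTop_nhdsGT_zero.comp tendsto_natCast_atTop_atTop)
  refine this.congr fun n => ?_
  simp [div_eq_mul_inv]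

lemma tendsto_mul_tan_div (x : ℝ) :
    Tendsto (fun n : ℕ => (n : ℝ) * Real.tan (x / n)) atTop (𝓝 x) := by
  have h' : HasDerivAt (fun t : ℝ => Real.tan (x * t)) x 0 := by
    have h0 : HasDerivAt Real.tan (1 / Real.cos (x * 0) ^ 2) (x * 0) :=
      Real.hasDerivAt_tan (by simp)
    simpa [Function.comp_def] using h0.comp 0 ((hasDerivAt_id (0:ℝ)).const_mul x)
  have := h'.tendsto_slope_zero_right.comp
    (tendsto_inv_atTop_nhdsGT_zero.comp tendsto_natCast_atTop_atTop)
  refine this.congr fun n => ?_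
  simp [div_eq_mul_inv]

/-- Cut the arc into `n` equal disjoint pieces, bound each below by its chord, and let `n` tend to
infinity. -/
lemma le_hausdorffMeasure_circleArc (c : EPlane) {r : ℝ} (hr : 0 < r) {a b : ℝ} (hab : a ≤ b)
    (hb : b - a ≤ 2 * Real.pi) :
    ENNReal.ofReal (r * (b - a)) ≤ Measure.hausdorffMeasure 1 (circleArc c r a b) := by
  have key : ∀ n : ℕ, 0 < n →
      ENNReal.ofReal (2 * r * (n * Real.sin ((b - a) / 2 / n))) ≤
        Measure.hausdorffMeasure 1 (circleArc c r a b) := by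
    intro n hn
    have hn' : (0 : ℝ) < n := by exact_mod_cast hn
    set δ := (b - a) / n with hδ
    have hδ0 : 0 ≤ δ := div_nonneg (by linarith) hn'.le
    have hnδ : n * δ = b - a := by rw [hδ]; field_simp
    have hsub : ∀ k ∈ Finset.range n, Ico (a + k * δ) (a + (k + 1) * δ) ⊆ Ico a b := by
      intro k hk
      have hk1 : ((k : ℝ) + 1) ≤ n := by exact_mod_cast Finset.mem_range.1 hk
      refine Ico_subset_Ico ?_ ?_
      · have : 0 ≤ (k : ℝ) * δ := by positivity
        linarith
      · nlinarith
    have hlen : ∀ k : ℕ, a + ((k : ℝ) + 1) * δ - (a + k * δ) = δ := fun k => by ring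
    have hδb : δ ≤ 2 * Real.pi := by
      have : (1 : ℝ) ≤ n := by exact_mod_cast hn
      nlinarith
    have hU : (⋃ k ∈ Finset.range n, circleArc c r (a + k * δ) (a + (k + 1) * δ)) ⊆
        circleArc c r a b := by
      refine iUnion₂_subset fun k hk => image_mono (hsub k hk)
    have hdisj : (↑(Finset.range n) : Set ℕ).PairwiseDisjoint
        fun k : ℕ => circleArc c r (a + k * δ) (a + (k + 1) * δ) := by
      intro i hi j hj hij
      have hI : Disjoint (Ico (a + i * δ) (a + (i + 1) * δ))
          (Ico (a + j * δ) (a + (j + 1) * δ)) := by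
        rw [Set.disjoint_left]
        rintro x ⟨h1, h2⟩ ⟨h3, h4⟩
        rcases lt_or_gt_of_ne hij with h | h
        · have : ((i : ℝ) + 1) ≤ j := by exact_mod_cast h
          nlinarith
        · have : ((j : ℝ) + 1) ≤ i := by exact_mod_cast h
          nlinarith
      exact hI.image (injOn_circle c hr hb) (hsub i hi) (hsub j hj)
    refine le_trans ?_ (measure_mono hU)
    rw [measure_biUnion_finset hdisj fun k _ => measurableSet_circleArc c hr (by rw [hlen]; exact hδb)]
    have hk : ∀ k ∈ Finset.range n, ENNReal.ofReal (2 * r * Real.sin (δ / 2)) ≤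
        Measure.hausdorffMeasure 1 (circleArc c r (a + k * δ) (a + (k + 1) * δ)) := by
      intro k _
      have := chord_le_hausdorffMeasure_circleArc c r
        (a := a + k * δ) (b := a + (k + 1) * δ) (by nlinarith)
      rwa [hlen] at this
    refine le_trans (le_of_eq ?_) (Finset.sum_le_sum hk)
    rw [Finset.sum_const, Finset.card_range, nsmul_eq_mul, ← ENNReal.ofReal_natCast,
      ← ENNReal.ofReal_mul hn'.le]
    congr 1
    rw [hδ, div_right_comm]
    ring
  have ht : Tendsto (fun n : ℕ => ENNReal.ofReal (2 * r * (n * Real.sin ((b - a) / 2 / n)))) atTop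
      (𝓝 (ENNReal.ofReal (r * (b - a)))) := by
    have := ENNReal.tendsto_ofReal ((tendsto_mul_sin_div ((b - a) / 2)).const_mul (2 * r))
    rwa [show 2 * r * ((b - a) / 2) = r * (b - a) by ring] at this
  exact le_of_tendsto ht (eventually_gt_atTop 0 |>.mono key)

lemma le_perimeter_closedBall (c : EPlane) {r : ℝ} (hr : 0 ≤ r) :
    ENNReal.ofReal (2 * Real.pi * r) ≤ perimeter (Metric.closedBall c r) := by
  rcases hr.eq_or_lt with rfl | hr
  · simp
  have hint : (interior (Metric.closedBall c r)).Nonempty :=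
    ⟨c, by rw [interior_closedBall _ hr.ne']; exact Metric.mem_ball_self hr⟩
  rw [perimeter, if_pos hint, frontier_closedBall _ hr.ne']
  have h := le_hausdorffMeasure_circleArc c hr (a := 0) (b := 2 * Real.pi)
    (by positivity) (by simp)
  rw [sub_zero, mul_comm r] at h
  refine h.trans (measure_mono ?_)
  rintro _ ⟨θ, -, rfl⟩
  simp [norm_smul, norm_unitDir, abs_of_pos hr]

/-! ### Compactness of convex hulls -/

/-- In finite dimensions the convex hull of a compact set is compact. -/
lemma IsCompact.convexHull_of_finiteDimensional {E : Type*} [NormedAddCommGroup E]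
    [NormedSpace ℝ E] [FiniteDimensional ℝ E] {s : Set E} (hs : IsCompact s) :
    IsCompact (convexHull ℝ s) := by
  -- Carathéodory: `finrank + 1` points suffice, so the hull is a finite union of continuous images
  -- of compact sets.
  have heq : convexHull ℝ s = ⋃ m ∈ Finset.range (Module.finrank ℝ E + 2),
      (fun q : (Fin m → ℝ) × (Fin m → E) => ∑ i, q.1 i • q.2 i) ''
        (stdSimplex ℝ (Fin m) ×ˢ univ.pi fun _ => s) := by
    refine Subset.antisymm (fun x hx => ?_) (iUnion₂_subset fun m _ => ?_)
    · obtain ⟨ι, _, z, w, hz, hind, hw, hw1, hwx⟩ := eq_pos_convex_span_of_mem_convexHull hx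
      let e := Fintype.equivFin ι
      have hcard : Fintype.card ι < Module.finrank ℝ E + 2 := by
        have h1 := hind.card_le_finrank_succ
        have h2 := (vectorSpan ℝ (range z)).finrank_le
        omega
      refine mem_iUnion₂.2 ⟨_, Finset.mem_range.2 hcard, (w ∘ e.symm, z ∘ e.symm),
        ⟨⟨fun i => (hw _).le, ?_⟩, fun i _ => hz (mem_range_self _)⟩, ?_⟩
      · rw [← hw1]
        exact Equiv.sum_comp e.symm w
      · rw [← hwx]
        exact Equiv.sum_comp e.symm fun i => w i • z i
    · rintro _ ⟨⟨w, z⟩, ⟨⟨hw0, hw1⟩, hz⟩, rfl⟩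
      exact (convex_convexHull ℝ s).sum_mem (fun i _ => hw0 i) hw1
        fun i _ => subset_convexHull ℝ s (hz i (mem_univ i))
  rw [heq]
  refine (Finset.range _).isCompact_biUnion fun m _ => ?_
  exact ((isCompact_stdSimplex ℝ _).prod (isCompact_univ_pi fun _ => hs)).image (by fun_prop)

/-! ### Support functions and largest inscribed disks -/

/-- The support function of a set in the plane. -/
noncomputable def supportFn (P : Set EPlane) (u : EPlane) : ℝ :=
  sSup ((fun x => inner ℝ u x) '' P)

namespace IsConvexShape

variable {P : Set EPlane}

lemma inner_le_supportFn (hP : IsConvexShape P) (u : EPlane) {x : EPlane} (hx : x ∈ P) :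
    inner ℝ u x ≤ supportFn P u :=
  le_csSup ((hP.isCompact.image (by fun_prop)).bddAbove) (mem_image_of_mem _ hx)

lemma exists_inner_eq_supportFn (hP : IsConvexShape P) (u : EPlane) :
    ∃ x ∈ P, inner ℝ u x = supportFn P u :=
  (hP.isCompact.image (by fun_prop)).sSup_mem (hP.nonempty.image (fun x => inner ℝ u x))

lemma supportFn_le (hP : IsConvexShape P) {u : EPlane} {c : ℝ}
    (h : ∀ x ∈ P, inner ℝ u x ≤ c) : supportFn P u ≤ c := by
  obtain ⟨x, hx, hxu⟩ := hP.exists_inner_eq_supportFn u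
  exact hxu ▸ h x hx

lemma continuous_supportFn (hP : IsConvexShape P) : Continuous (supportFn P) :=
  hP.isCompact.continuous_sSup (f := fun u x : EPlane => inner ℝ u x) (by fun_prop)

lemma exists_nearest (hP : IsConvexShape P) (x : EPlane) :
    ∃ p ∈ P, ∀ w ∈ P, inner ℝ (x - p) (w - p) ≤ 0 := by
  obtain ⟨p, hp, h⟩ := exists_norm_eq_iInf_of_complete_convex hP.nonempty
    hP.isCompact.isComplete hP.convex x
  exact ⟨p, hp, (norm_eq_iInf_iff_real_inner_le_zero hP.convex hp).1 h⟩

lemma exists_supportFn_lt (hP : IsConvexShape P) {x : EPlane} (hx : x ∉ P) :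
    ∃ u : EPlane, ‖u‖ = 1 ∧ supportFn P u < inner ℝ u x := by
  obtain ⟨p, hp, h⟩ := hP.exists_nearest x
  have hxp : x - p ≠ 0 := fun h0 => hx (by rwa [sub_eq_zero.1 h0])
  have hn : 0 < ‖x - p‖ := norm_pos_iff.2 hxp
  refine ⟨‖x - p‖⁻¹ • (x - p), norm_smul_inv_norm hxp, ?_⟩
  refine lt_of_le_of_lt (hP.supportFn_le (c := inner ℝ (‖x - p‖⁻¹ • (x - p)) p) ?_) ?_
  · intro w hw
    rw [← sub_nonpos, ← inner_sub_right, real_inner_smul_left]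
    exact mul_nonpos_of_nonneg_of_nonpos (inv_nonneg.2 hn.le) (h w hw)
  · rw [← sub_pos, ← inner_sub_right, real_inner_smul_left, real_inner_self_eq_norm_sq]
    positivity

/-- A point of the ball outside `P` would be strictly separated from `P` by a unit direction,
contradicting the support inequality there. -/
lemma closedBall_subset (hP : IsConvexShape P) {c : EPlane} {r : ℝ}
    (h : ∀ u : EPlane, ‖u‖ = 1 → inner ℝ u c + r ≤ supportFn P u) :
    Metric.closedBall c r ⊆ P := by
  intro x hx
  by_contra hxP
  obtain ⟨u, hu, hlt⟩ := hP.exists_supportFn_lt hxP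
  have h1 : inner ℝ u (x - c) ≤ r := by
    refine (real_inner_le_norm u (x - c)).trans ?_
    rw [hu, one_mul, ← dist_eq_norm]
    exact hx
  rw [inner_sub_right] at h1
  linarith [h u hu]

lemma add_le_supportFn (hP : IsConvexShape P) {c : EPlane} {r : ℝ} (hr : 0 ≤ r)
    (h : Metric.closedBall c r ⊆ P) {u : EPlane} (hu : ‖u‖ = 1) :
    inner ℝ u c + r ≤ supportFn P u := by
  have := hP.inner_le_supportFn u (x := c + r • u)
    (h (by simp [norm_smul, hu, abs_of_nonneg hr]))
  rwa [inner_add_right, real_inner_smul_right, real_inner_self_eq_norm_sq, hu, one_pow,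
    mul_one] at this

/-- If no unit direction supported `P` at `y`, the support gap would have a positive minimum on the
unit circle, and a ball of that radius about `y` would lie in `P`. -/
lemma exists_supporting_normal (hP : IsConvexShape P) {y : EPlane} (hy : y ∈ frontier P) :
    ∃ u : EPlane, ‖u‖ = 1 ∧ inner ℝ u y = supportFn P u := by
  have hyP : y ∈ P := hP.isCompact.isClosed.frontier_subset hy
  by_contra! hne
  have hlt : ∀ u : EPlane, ‖u‖ = 1 → 0 < supportFn P u - inner ℝ u y := fun u hu =>
    sub_pos.2 (lt_of_le_of_ne (hP.inner_le_supportFn u hyP) (hne u hu))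
  have hcont : Continuous fun u : EPlane => supportFn P u - inner ℝ u y :=
    hP.continuous_supportFn.sub (by fun_prop)
  obtain ⟨u₀, hu₀, hmin⟩ := (isCompact_sphere (0 : EPlane) 1).exists_isMinOn
    ⟨unitDir 0, by simp [norm_unitDir]⟩ hcont.continuousOn
  have hsub : Metric.closedBall y (supportFn P u₀ - inner ℝ u₀ y) ⊆ P := by
    refine hP.closedBall_subset fun u hu => ?_
    have := isMinOn_iff.1 hmin u (by simpa using hu)
    linarith
  have hpos := hlt u₀ (by simpa using hu₀)
  refine hy.2 (mem_interior_iff_mem_nhds.2 ?_)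
  exact Filter.mem_of_superset (Metric.closedBall_mem_nhds y hpos) hsub

/-- The inradius at a point is its distance to the complement, a continuous function that attains
its maximum on `P`. -/
lemma exists_isLargestInscribedDisk (hP : IsConvexShape P) :
    ∃ D, IsLargestInscribedDisk D P := by
  have hne : (Pᶜ).Nonempty := nonempty_compl.2 hP.isCompact.ne_univ
  obtain ⟨c, hc, hmax⟩ := hP.isCompact.exists_isMaxOn hP.nonempty
    (Metric.continuous_infDist_pt Pᶜ).continuousOn
  refine ⟨_, c, Metric.infDist c Pᶜ, Metric.infDist_nonneg, rfl, ?_, ?_⟩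
  · rcases (Metric.infDist_nonneg (x := c) (s := Pᶜ)).eq_or_lt with h | h
    · rw [← h, Metric.closedBall_zero]
      exact singleton_subset_iff.2 hc
    · rw [← closure_ball c h.ne']
      exact closure_minimal Metric.ball_infDist_compl_subset hP.isCompact.isClosed
  · intro c' r' hr' hsub
    refine le_trans ?_ (isMaxOn_iff.1 hmax c' (hsub (Metric.mem_closedBall_self hr')))
    refine (Metric.le_infDist hne).2 fun y hy => ?_
    by_contra! hlt
    exact hy (hsub (by rw [Metric.mem_closedBall, dist_comm]; exact hlt.le))

/-- The outer normals at the contact points of a largest inscribed disk are balanced. -/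
lemma exists_balanced_normals (hP : IsConvexShape P) {c : EPlane} {r : ℝ} (hr : 0 ≤ r)
    (hsub : Metric.closedBall c r ⊆ P)
    (hmax : ∀ (c' : EPlane) (r' : ℝ), 0 ≤ r' → Metric.closedBall c' r' ⊆ P → r' ≤ r) :
    ∃ (ι : Type) (_ : Fintype ι) (w : ι → ℝ) (u : ι → EPlane), (∀ i, 0 ≤ w i) ∧
      ∑ i, w i = 1 ∧ (∀ i, ‖u i‖ = 1) ∧ (∀ i, supportFn P (u i) = inner ℝ (u i) c + r) ∧
      ∑ i, w i • u i = 0 := by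
  set g : EPlane → ℝ := fun u => supportFn P u - inner ℝ u c - r with hg
  have hgc : Continuous g := (hP.continuous_supportFn.sub (by fun_prop)).sub continuous_const
  have hg0 : ∀ u : EPlane, ‖u‖ = 1 → 0 ≤ g u := fun u hu => by
    have := hP.add_le_supportFn hr hsub hu
    simp only [hg]; linarith
  set A : Set EPlane := Metric.sphere 0 1 ∩ {u | g u = 0} with hA
  have hAc : IsCompact A :=
    (isCompact_sphere _ _).inter_right (isClosed_eq hgc continuous_const)
  suffices h0 : (0 : EPlane) ∈ convexHull ℝ A by
    obtain ⟨ι, hι, w, z, hw, hw1, hz, hs⟩ := mem_convexHull_iff_exists_fintype.1 h0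
    refine ⟨ι, hι, w, z, hw, hw1, fun i => by simpa using (hz i).1, fun i => ?_, hs⟩
    have := (hz i).2
    simp only [hg, mem_ofPred_eq] at this
    linarith
  -- Otherwise some `v` has positive inner product with every contact normal. Moving the centre
  -- along `-v` opens a gap at all contacts.
  by_contra h0
  obtain ⟨f, b, hf0, hfb⟩ := geometric_hahn_banach_point_closed (convex_convexHull ℝ A)
    hAc.convexHull_of_finiteDimensional.isClosed h0
  rw [map_zero] at hf0
  set v := (InnerProductSpace.toDual ℝ EPlane).symm f with hv
  have hvA : ∀ u ∈ A, 0 < inner ℝ v u := fun u hu => by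
    rw [hv, InnerProductSpace.toDual_symm_apply]
    exact hf0.trans (hfb u (subset_convexHull ℝ A hu))
  -- These are the directions in which the move does not enlarge the gap. None is a contact normal,
  -- so by compactness the gap `g` is at least some `m > 0` on them.
  set C : Set EPlane := Metric.sphere 0 1 ∩ {u | inner ℝ v u ≤ 0} with hC
  have hCc : IsCompact C :=
    (isCompact_sphere _ _).inter_right (isClosed_le (by fun_prop) continuous_const)
  obtain ⟨m, hm0, hm⟩ : ∃ m > 0, ∀ u ∈ C, m ≤ g u := by
    rcases C.eq_empty_or_nonempty with h | h
    · exact ⟨1, one_pos, by simp [h]⟩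
    · obtain ⟨u₀, hu₀, hmin⟩ := hCc.exists_isMinOn h hgc.continuousOn
      refine ⟨g u₀, lt_of_le_of_ne (hg0 u₀ (by simpa using hu₀.1)) fun h => ?_,
        fun u hu => isMinOn_iff.1 hmin u hu⟩
      exact absurd (hvA u₀ ⟨hu₀.1, h.symm⟩) (not_lt.2 hu₀.2)
  -- Chosen so that `ε * ‖v‖ < m`: the move cannot use up the gap available on `C`.
  set ε : ℝ := m / (‖v‖ + 1) with hε
  have hv1 : 0 < ‖v‖ + 1 := by positivity
  have hε0 : 0 < ε := div_pos hm0 hv1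
  have hεm : ε * (‖v‖ + 1) = m := div_mul_cancel₀ _ hv1.ne'
  have hpos : ∀ u ∈ Metric.sphere (0 : EPlane) 1, 0 < g u + ε * inner ℝ v u := by
    intro u hu
    have hu1 : ‖u‖ = 1 := by simpa using hu
    rcases le_or_gt (inner ℝ v u) 0 with h | h
    · have h1 := hm u ⟨hu, h⟩
      have h2 : -‖v‖ ≤ inner ℝ v u := by
        have := neg_le_of_abs_le (abs_real_inner_le_norm v u)
        rwa [hu1, mul_one] at this
      nlinarith
    · have := hg0 u hu1
      positivity
  have hcont : Continuous fun u : EPlane => g u + ε * inner ℝ v u :=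
    hgc.add (by fun_prop)
  obtain ⟨u₀, hu₀, hmin⟩ := (isCompact_sphere (0 : EPlane) 1).exists_isMinOn
    ⟨unitDir 0, by simp [norm_unitDir]⟩ hcont.continuousOn
  set η := g u₀ + ε * inner ℝ v u₀ with hη
  have hη0 : 0 < η := hpos u₀ hu₀
  have := hmax (c - ε • v) (r + η) (by positivity) (hP.closedBall_subset fun u hu => ?_)
  · linarith
  · have h1 := isMinOn_iff.1 hmin u (by simpa using hu)
    rw [inner_sub_right, real_inner_smul_right, real_inner_comm v u]
    simp only [hg] at h1
    simp only [hη, hg]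
    linarith

/-! ### Thickenings and shapes without interior -/

lemma cthickening (hP : IsConvexShape P) (ε : ℝ) : IsConvexShape (Metric.cthickening ε P) :=
  ⟨hP.nonempty.mono (Metric.self_subset_cthickening P), hP.isCompact.cthickening,
    hP.convex.cthickening ε⟩

lemma supportFn_cthickening_le (hP : IsConvexShape P) {ε : ℝ} (hε : 0 ≤ ε) {u : EPlane}
    (hu : ‖u‖ = 1) : supportFn (Metric.cthickening ε P) u ≤ supportFn P u + ε := by
  refine (hP.cthickening ε).supportFn_le fun x hx => ?_
  rw [hP.isCompact.cthickening_eq_biUnion_closedBall hε] at hx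
  obtain ⟨y, hy, hxy⟩ := mem_iUnion₂.1 hx
  have h1 : inner ℝ u (x - y) ≤ ε := by
    refine (real_inner_le_norm u (x - y)).trans ?_
    rw [hu, one_mul, ← dist_eq_norm]
    exact hxy
  rw [inner_sub_right] at h1
  linarith [hP.inner_le_supportFn u hy]

lemma mem_frontier (hP : IsConvexShape P) {x u : EPlane} (hx : x ∈ P) (hu : ‖u‖ = 1)
    (hxu : inner ℝ u x = supportFn P u) : x ∈ frontier P := by
  rw [hP.isCompact.isClosed.frontier_eq]
  refine ⟨hx, fun hint => ?_⟩
  obtain ⟨δ, hδ, hsub⟩ := Metric.nhds_basis_closedBall.mem_iff.1 (mem_interior_iff_mem_nhds.1 hint)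
  have := hP.add_le_supportFn hδ.le hsub hu
  linarith

/-- A convex set with empty interior has a proper affine span, and any unit vector orthogonal to its
direction space works. -/
lemma exists_inner_eq_of_interior_eq_empty (hP : IsConvexShape P)
    (h : ¬(interior P).Nonempty) :
    ∃ (u : EPlane) (c : ℝ), ‖u‖ = 1 ∧ ∀ x ∈ P, inner ℝ u x = c := by
  rw [hP.convex.interior_nonempty_iff_affineSpan_eq_top] at h
  obtain ⟨x₀, hx₀⟩ := hP.nonempty
  have hdir : vectorSpan ℝ P ≠ ⊤ := fun ht =>
    h ((AffineSubspace.affineSpan_eq_top_iff_vectorSpan_eq_top_of_nonempty ℝ EPlane EPlane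
      ⟨x₀, hx₀⟩).2 ht)
  have hperp : (vectorSpan ℝ P)ᗮ ≠ ⊥ := fun hb => hdir (Submodule.orthogonal_eq_bot_iff.1 hb)
  obtain ⟨v, hv, hv0⟩ := Submodule.exists_mem_ne_zero_of_ne_bot hperp
  refine ⟨‖v‖⁻¹ • v, inner ℝ (‖v‖⁻¹ • v) x₀, norm_smul_inv_norm hv0, fun x hx => ?_⟩
  rw [← sub_eq_zero, ← inner_sub_right, real_inner_smul_left,
    Submodule.inner_left_of_mem_orthogonal (K := vectorSpan ℝ P) (u := x - x₀)
      (vsub_mem_vectorSpan ℝ hx hx₀) hv, mul_zero]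

/-- A convex shape without interior points is seen twice in the boundary of its thickenings. -/
lemma two_mul_hausdorffMeasure_le (hP : IsConvexShape P) (h : ¬(interior P).Nonempty)
    {ε : ℝ} (hε : 0 < ε) :
    2 * Measure.hausdorffMeasure 1 P ≤
      Measure.hausdorffMeasure 1 (frontier (Metric.cthickening ε P)) := by
  obtain ⟨u, c, hu, huc⟩ := hP.exists_inner_eq_of_interior_eq_empty h
  have hmeas : ∀ t : EPlane, Measure.hausdorffMeasure 1 ((fun x => x + t) '' P) =
      Measure.hausdorffMeasure 1 P := fun t =>
    (IsometryEquiv.addRight t).isometry.hausdorffMeasure_image (Or.inl zero_le_one) P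
  -- Along a direction `v` that is constant on `P`, the translate of `P` by `ε • v` attains the
  -- support value of the thickening. This is applied to `u` and `-u`, giving two disjoint copies of
  -- `P`.
  have hfr : ∀ v : EPlane, ‖v‖ = 1 → (∃ a, ∀ x ∈ P, inner ℝ v x = a) →
      (fun x => x + ε • v) '' P ⊆ frontier (Metric.cthickening ε P) := by
    rintro v hv ⟨a, ha⟩ _ ⟨x, hx, rfl⟩
    have hmem : x + ε • v ∈ Metric.cthickening ε P := by
      refine Metric.mem_cthickening_of_dist_le _ x _ _ hx ?_
      simp [norm_smul, hv, abs_of_pos hε]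
    refine (hP.cthickening ε).mem_frontier hmem hv (le_antisymm ?_ ?_)
    · exact (hP.cthickening ε).inner_le_supportFn v hmem
    · refine (hP.supportFn_cthickening_le hε.le hv).trans ?_
      have := hP.supportFn_le fun y hy => (ha y hy).le
      simp only [inner_add_right, real_inner_smul_right, real_inner_self_eq_norm_sq, hv, ha x hx]
      linarith
  have hdisj : Disjoint ((fun x => x + ε • u) '' P) ((fun x => x + ε • (-u)) '' P) := by
    rw [Set.disjoint_left]
    rintro _ ⟨x, hx, rfl⟩ ⟨y, hy, hxy⟩
    have := congrArg (fun z => inner ℝ u z) hxy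
    simp only [inner_add_right, real_inner_smul_right, inner_neg_right,
      real_inner_self_eq_norm_sq, hu, huc x hx, huc y hy] at this
    linarith
  rw [two_mul]
  nth_rewrite 1 [← hmeas (ε • u)]
  rw [← hmeas (ε • (-u)), ← measure_union hdisj
    (hP.isCompact.image (by fun_prop)).measurableSet]
  refine measure_mono (union_subset (hfr u hu ⟨c, huc⟩) (hfr (-u) (by simpa using hu) ⟨-c, ?_⟩))
  intro x hx
  rw [inner_neg_left, huc x hx]

end IsConvexShape

/-! ### Boundary length and circumscribed equiangular polygons -/

lemma two_cos_mul_inner_unitDir (θ α : ℝ) (x : EPlane) :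
    2 * Real.cos α * inner ℝ (unitDir θ) x =
      inner ℝ (unitDir (θ + α)) x + inner ℝ (unitDir (θ - α)) x := by
  simp only [inner_plane, unitDir_zero_coord, unitDir_one_coord, Real.cos_add, Real.cos_sub,
    Real.sin_add, Real.sin_sub]
  ring

/-- This makes the side lengths of the circumscribed polygon nonnegative, as needed to sum them
inside `ENNReal.ofReal`. -/
lemma IsConvexShape.two_cos_mul_supportFn_le {P : Set EPlane} (hP : IsConvexShape P) (θ α : ℝ) :
    2 * Real.cos α * supportFn P (unitDir θ) ≤
      supportFn P (unitDir (θ + α)) + supportFn P (unitDir (θ - α)) := by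
  obtain ⟨x, hx, hxu⟩ := hP.exists_inner_eq_supportFn (unitDir θ)
  rw [← hxu, two_cos_mul_inner_unitDir]
  exact add_le_add (hP.inner_le_supportFn _ hx) (hP.inner_le_supportFn _ hx)

/-- The length of a side of a polygon given by three consecutive side lines. -/
lemma hausdorffMeasure_side_le (θ : ℝ) {α : ℝ} (hα : 0 < Real.sin α) (c p q : ℝ) :
    Measure.hausdorffMeasure 1 {x : EPlane | inner ℝ (unitDir θ) x = c ∧
      inner ℝ (unitDir (θ + α)) x ≤ p ∧ inner ℝ (unitDir (θ - α)) x ≤ q} ≤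
      ENNReal.ofReal ((p + q - 2 * Real.cos α * c) / Real.sin α) := by
  -- Arc-length parametrisation of the side line. The two neighbouring constraints confine `s` to an
  -- interval.
  set f : ℝ → EPlane := fun s => c • unitDir θ + s • unitDir (θ + Real.pi / 2) with hf
  have hfL : LipschitzWith 1 f := by
    refine LipschitzWith.of_dist_le_mul fun s t => ?_
    rw [dist_eq_norm, hf]
    simp only [add_sub_add_left_eq_sub, ← sub_smul, norm_smul, norm_unitDir]
    simp [Real.dist_eq]
  set I := Icc (-((q - Real.cos α * c) / Real.sin α)) ((p - Real.cos α * c) / Real.sin α)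
  have hsub : {x : EPlane | inner ℝ (unitDir θ) x = c ∧
      inner ℝ (unitDir (θ + α)) x ≤ p ∧ inner ℝ (unitDir (θ - α)) x ≤ q} ⊆ f '' I := by
    rintro x ⟨hx, hp, hq⟩
    have hxe := eq_add_unitDir θ x
    rw [real_inner_comm, hx] at hxe
    set s := inner ℝ x (unitDir (θ + Real.pi / 2))
    rw [hxe, inner_add_right, real_inner_smul_right, real_inner_smul_right,
      inner_unitDir_unitDir, inner_unitDir_unitDir] at hp hq
    have e1 : θ + α - (θ + Real.pi / 2) = α - Real.pi / 2 := by ring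
    have e2 : θ - α - (θ + Real.pi / 2) = -(α + Real.pi / 2) := by ring
    rw [add_sub_cancel_left, e1, Real.cos_sub_pi_div_two] at hp
    rw [sub_sub_cancel_left, Real.cos_neg, e2, Real.cos_neg, Real.cos_add_pi_div_two] at hq
    refine ⟨s, ⟨?_, ?_⟩, hxe.symm⟩
    · rw [neg_le, le_div_iff₀ hα]; linarith
    · rw [le_div_iff₀ hα]; linarith
  refine (measure_mono hsub).trans ?_
  have h1 := hfL.lipschitzOnWith.hausdorffMeasure_image_le (d := 1) (s := I) zero_le_one
  simp only [ENNReal.coe_one, ENNReal.one_rpow, one_mul] at h1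
  refine h1.trans (le_of_eq ?_)
  rw [hausdorffMeasure_real, Real.volume_Icc]
  congr 1
  ring

lemma unitDir_add_two_pi (θ : ℝ) : unitDir (θ + 2 * Real.pi) = unitDir θ := by
  simp [unitDir]

/-- For the nearest-point map, adding the variational inequalities at `x` and `y` gives `‖f x - f y‖
^ 2 ≤ inner ℝ (x - y) (f x - f y)`; Cauchy–Schwarz finishes. -/
lemma exists_nearest_lipschitz {P : Set EPlane} (hP : IsConvexShape P) :
    ∃ f : EPlane → EPlane, LipschitzWith 1 f ∧ (∀ x, f x ∈ P) ∧
      ∀ x, ∀ w ∈ P, inner ℝ (x - f x) (w - f x) ≤ 0 := by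
  choose f hf hfw using hP.exists_nearest
  refine ⟨f, LipschitzWith.of_dist_le_mul fun x y => ?_, hf, hfw⟩
  rw [NNReal.coe_one, one_mul, dist_eq_norm, dist_eq_norm]
  have h1 := hfw x (f y) (hf y)
  have h2 := hfw y (f x) (hf x)
  have h3 : ‖f x - f y‖ ^ 2 ≤ inner ℝ (x - y) (f x - f y) := by
    rw [← real_inner_self_eq_norm_sq]
    simp only [inner_sub_left, inner_sub_right] at *
    linarith
  have h4 := real_inner_le_norm (x - y) (f x - f y)
  rcases (norm_nonneg (f x - f y)).eq_or_lt with h | h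
  · rw [← h]; exact norm_nonneg _
  · nlinarith

/-- The circumscribed equiangular polygon bounds the length of the boundary. -/
lemma hausdorffMeasure_frontier_le_sum {P : Set EPlane} (hP : IsConvexShape P) (φ : ℝ)
    {m : ℕ} (hm : 0 < m) {α : ℝ} (hα : α = Real.pi / (2 * m)) :
    Measure.hausdorffMeasure 1 (frontier P) ≤
      ENNReal.ofReal (2 * Real.tan (α / 2) *
        ∑ k ∈ Finset.range (4 * m), supportFn P (unitDir (φ + k * α))) := by
  have hm' : (0 : ℝ) < m := by exact_mod_cast hm
  have hm1 : (1 : ℝ) ≤ m := by exact_mod_cast hm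
  have hmα : m * α = Real.pi / 2 := by rw [hα]; field_simp
  have hα0 : 0 < α := by rw [hα]; positivity
  have hαpi : α ≤ Real.pi / 2 := by nlinarith
  have hsin : 0 < Real.sin α := Real.sin_pos_of_pos_of_lt_pi hα0 (by linarith [Real.pi_pos])
  -- A real index lets `k - 1` mean the preceding angle also at `k = 0`; `hper` then closes the
  -- cycle, since `4 * m * α = 2π`.
  set H : ℝ → ℝ := fun t => supportFn P (unitDir (φ + t * α)) with hH
  have hper : ∀ t : ℝ, unitDir (φ + (t + 4 * m) * α) = unitDir (φ + t * α) := fun t => by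
    rw [← unitDir_add_two_pi (φ + t * α)]
    congr 1
    linear_combination 4 * hmα
  set side : ℕ → Set EPlane := fun k => {x | inner ℝ (unitDir (φ + k * α)) x = H k ∧
      inner ℝ (unitDir (φ + k * α + α)) x ≤ H (k + 1) ∧
      inner ℝ (unitDir (φ + k * α - α)) x ≤ H (k - 1)} with hside
  obtain ⟨f, hfL, hfP, hfw⟩ := exists_nearest_lipschitz hP
  -- From a boundary point `y`, follow an outer normal until it first meets a side line. The point
  -- reached lies on the polygon, and its nearest point in `P` is `y`.
  have hcover : frontier P ⊆ f '' ⋃ k ∈ Finset.range (4 * m), side k := by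
    intro y hy
    have hyP : y ∈ P := hP.isCompact.isClosed.frontier_subset hy
    obtain ⟨v, hv, hvy⟩ := hP.exists_supporting_normal hy
    obtain ⟨ψ, rfl⟩ := exists_eq_unitDir hv
    set d : ℕ → ℝ := fun k => inner ℝ (unitDir (φ + k * α)) (unitDir ψ) with hd
    set S := (Finset.range (4 * m)).filter fun k => 0 < d k with hS
    -- The indices `0, m, 2m, 3m` give four directions at right angles, and these cannot all have
    -- nonpositive inner product with the unit vector at `ψ`.
    have hSne : S.Nonempty := by
      have hmem : ∀ k, k < 4 * m → 0 < d k → S.Nonempty := fun k h1 h2 =>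
        ⟨k, Finset.mem_filter.2 ⟨Finset.mem_range.2 h1, h2⟩⟩
      have hval : ∀ j : ℕ, d (j * m) = Real.cos (φ - ψ + j * (Real.pi / 2)) := fun j => by
        rw [hd]
        simp only [inner_unitDir_unitDir]
        congr 1
        push_cast
        linear_combination (j : ℝ) * hmα
      have h0 := hval 0
      have h1 := hval 1
      have h2 := hval 2
      have h3 := hval 3
      rw [Nat.cast_zero, zero_mul (Real.pi / 2), add_zero] at h0
      rw [Nat.cast_one, one_mul (Real.pi / 2), Real.cos_add_pi_div_two] at h1
      rw [Nat.cast_ofNat, mul_div_cancel₀ _ two_ne_zero, Real.cos_add_pi] at h2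
      rw [Nat.cast_ofNat, show φ - ψ + 3 * (Real.pi / 2) = φ - ψ + Real.pi / 2 + Real.pi by ring,
        Real.cos_add_pi, Real.cos_add_pi_div_two] at h3
      by_contra hne
      have hle : ∀ j < 4, d (j * m) ≤ 0 := fun j hj => by
        by_contra! h
        exact hne (hmem _ (by nlinarith) h)
      have h0' := hle 0 (by norm_num)
      have h1' := hle 1 (by norm_num)
      have h2' := hle 2 (by norm_num)
      have h3' := hle 3 (by norm_num)
      have hc : Real.cos (φ - ψ) = 0 := by linarith
      have hs : Real.sin (φ - ψ) = 0 := by linarith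
      have := Real.sin_sq_add_cos_sq (φ - ψ)
      rw [hc, hs] at this
      norm_num at this
    -- The quotient is the time at which the ray reaches line `k`; its minimiser is the first line
    -- hit.
    obtain ⟨k, hkS, hkmin⟩ := S.exists_min_image
      (fun k => (H k - inner ℝ (unitDir (φ + k * α)) y) / d k) hSne
    obtain ⟨hk, hdk⟩ := Finset.mem_filter.1 hkS
    set t := (H k - inner ℝ (unitDir (φ + k * α)) y) / d k with ht
    have ht0 : 0 ≤ t := div_nonneg (sub_nonneg.2 (hP.inner_le_supportFn _ hyP)) hdk.le
    have hall : ∀ j ∈ Finset.range (4 * m),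
        inner ℝ (unitDir (φ + j * α)) (y + t • unitDir ψ) ≤ H j := by
      intro j hj
      rw [inner_add_right, real_inner_smul_right]
      change _ + t * d j ≤ _
      rcases le_or_gt (d j) 0 with h | h
      · have h1 : inner ℝ (unitDir (φ + j * α)) y ≤ H j := hP.inner_le_supportFn _ hyP
        nlinarith
      · have h1 := hkmin j (Finset.mem_filter.2 ⟨hj, h⟩)
        rw [le_div_iff₀ h] at h1
        linarith
    have hz : y + t • unitDir ψ ∈ side k := by
      refine ⟨?_, ?_, ?_⟩
      · rw [inner_add_right, real_inner_smul_right]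
        change _ + t * d k = _
        rw [ht, div_mul_cancel₀ _ hdk.ne']
        ring
      · rw [show φ + k * α + α = φ + ((k : ℝ) + 1) * α by ring]
        rcases (Nat.succ_le_of_lt (Finset.mem_range.1 hk)).eq_or_lt with h | h
        · have e : (k : ℝ) + 1 = 0 + 4 * m := by rw [zero_add]; exact_mod_cast h
          have := hall 0 (Finset.mem_range.2 (by omega))
          simp only [hH, e, hper]
          simpa [hH] using this
        · have := hall (k + 1) (Finset.mem_range.2 h)
          push_cast at this
          exact this
      · rw [show φ + k * α - α = φ + ((k : ℝ) - 1) * α by ring]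
        rcases Nat.eq_zero_or_pos k with h | h
        · have := hall (4 * m - 1) (Finset.mem_range.2 (by omega))
          have e : ((4 * m - 1 : ℕ) : ℝ) = ((k : ℝ) - 1) + 4 * m := by
            rw [Nat.cast_sub (by omega), h]
            push_cast
            ring
          rw [e] at this
          simp only [hH, hper] at this ⊢
          exact this
        · have := hall (k - 1) (Finset.mem_range.2 (by have := Finset.mem_range.1 hk; omega))
          rw [Nat.cast_sub h, Nat.cast_one] at this
          exact this
    refine ⟨y + t • unitDir ψ, mem_iUnion₂.2 ⟨k, hk, hz⟩, ?_⟩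
    set p := f (y + t • unitDir ψ) with hp
    have h1 := hfw (y + t • unitDir ψ) y hyP
    have h2 := hP.inner_le_supportFn (unitDir ψ) (hfP (y + t • unitDir ψ))
    rw [← hvy, ← sub_nonneg, ← inner_sub_right] at h2
    rw [← hp, show y + t • unitDir ψ - p = (y - p) + t • unitDir ψ by abel, inner_add_left,
      real_inner_smul_left, real_inner_self_eq_norm_sq] at h1
    -- The normal supports `P` at `y`, so its inner product with `y - p` is nonnegative and the
    -- variational inequality at `p` leaves no room.
    have h3 : ‖y - p‖ ^ 2 ≤ 0 := by nlinarith
    have h4 : ‖y - p‖ = 0 := by nlinarith [norm_nonneg (y - p)]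
    exact (sub_eq_zero.1 (norm_eq_zero.1 h4)).symm
  refine (measure_mono hcover).trans ?_
  have h1 := hfL.lipschitzOnWith.hausdorffMeasure_image_le (d := 1)
    (s := ⋃ k ∈ Finset.range (4 * m), side k) zero_le_one
  simp only [ENNReal.coe_one, ENNReal.one_rpow, one_mul] at h1
  refine h1.trans ((measure_biUnion_finset_le _ _).trans ?_)
  refine (Finset.sum_le_sum fun (k : ℕ) _ => hausdorffMeasure_side_le (φ + k * α) hsin (H k)
    (H (k + 1)) (H (k - 1))).trans (le_of_eq ?_)
  rw [← ENNReal.ofReal_sum_of_nonneg]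
  · congr 1
    have hs1 : ∑ k ∈ Finset.range (4 * m), H (k + 1) = ∑ k ∈ Finset.range (4 * m), H k := by
      have h := (Finset.sum_range_succ (fun k : ℕ => H k) (4 * m)).symm.trans
        (Finset.sum_range_succ' (fun k : ℕ => H k) (4 * m))
      have hp : H ((4 * m : ℕ) : ℝ) = H ((0 : ℕ) : ℝ) := by
        have := hper 0
        simp only [hH]
        push_cast
        rw [← this, zero_add]
      push_cast at h hp
      linarith
    have hs2 : ∑ k ∈ Finset.range (4 * m), H (k - 1) = ∑ k ∈ Finset.range (4 * m), H k := by
      have h := (Finset.sum_range_succ (fun k : ℕ => H (k - 1)) (4 * m)).symm.trans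
        (Finset.sum_range_succ' (fun k : ℕ => H (k - 1)) (4 * m))
      have hp : H ((4 * m : ℕ) - 1) = H ((0 : ℕ) - 1) := by
        have := hper (-1)
        simp only [hH]
        push_cast
        rw [zero_sub, ← this]
        congr 3
        ring
      push_cast at h hp
      simp only [add_sub_cancel_right] at h
      linarith
    rw [← Finset.sum_div, Finset.sum_sub_distrib, Finset.sum_add_distrib, hs1, hs2,
      ← Finset.mul_sum]
    -- After the cyclic shifts each side contributes `(2 - 2 cos α) / sin α` times its support
    -- value, which is `2 tan (α / 2)` times it.
    have htan : Real.tan (α / 2) * Real.sin α = 1 - Real.cos α := by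
      have hc : Real.cos (α / 2) ≠ 0 :=
        (Real.cos_pos_of_mem_Ioo ⟨by linarith, by linarith [Real.pi_pos]⟩).ne'
      have e : α = 2 * (α / 2) := by ring
      conv_lhs => rw [Real.tan_eq_sin_div_cos]; arg 2; rw [e, Real.sin_two_mul]
      conv_rhs => rw [e, Real.cos_two_mul]
      have := Real.sin_sq_add_cos_sq (α / 2)
      field_simp
      linear_combination 2 * this
    rw [div_eq_iff hsin.ne']
    linear_combination (-2 * ∑ k ∈ Finset.range (4 * m), H k) * htan
  · intro k _
    refine div_nonneg ?_ hsin.le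
    have := hP.two_cos_mul_supportFn_le (φ + k * α) α
    rw [show φ + k * α + α = φ + ((k : ℝ) + 1) * α by ring,
      show φ + k * α - α = φ + ((k : ℝ) - 1) * α by ring] at this
    simp only [hH]
    linarith

/-! ### From balanced averages to the perimeter bound -/

/-- If balanced averages of the support function are at most `r` in all rotated positions, then
the boundary is at most as long as a circle of radius `r`. -/
lemma hausdorffMeasure_frontier_le_of_average {P : Set EPlane} (hP : IsConvexShape P) {ι : Type}
    [Fintype ι] {w φ : ι → ℝ} {r : ℝ} (hw : ∀ i, 0 ≤ w i) (hw1 : ∑ i, w i = 1)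
    (h : ∀ θ : ℝ, ∑ i, w i * supportFn P (unitDir (φ i + θ)) ≤ r) :
    Measure.hausdorffMeasure 1 (frontier P) ≤ ENNReal.ofReal (2 * Real.pi * r) := by
  have key : ∀ m : ℕ, 0 < m → Measure.hausdorffMeasure 1 (frontier P) ≤
      ENNReal.ofReal (2 * (((4 * m : ℕ) : ℝ) * Real.tan (Real.pi / (4 * m : ℕ))) * r) := by
    intro m hm
    set α := Real.pi / (2 * m) with hα
    have hm1 : (1 : ℝ) ≤ m := by exact_mod_cast hm
    set S : ι → ℝ := fun i =>
      ∑ k ∈ Finset.range (4 * m), supportFn P (unitDir (φ i + k * α)) with hS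
    have havg : ∑ i, w i * S i ≤ (4 * m : ℕ) * r := by
      simp only [hS, Finset.mul_sum]
      rw [Finset.sum_comm]
      refine (Finset.sum_le_sum fun (k : ℕ) _ => h (k * α)).trans (le_of_eq ?_)
      rw [Finset.sum_const, Finset.card_range, nsmul_eq_mul]
    have hne : (Finset.univ : Finset ι).Nonempty := by
      by_contra hne
      rw [Finset.not_nonempty_iff_eq_empty.1 hne, Finset.sum_empty] at hw1
      exact zero_ne_one hw1
    -- Each `φ i` starts its own circumscribed polygon. The smallest of the sums is at most their
    -- weighted average, so one polygon suffices.
    obtain ⟨i, -, hi⟩ := Finset.univ.exists_min_image S hne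
    have hSi : S i ≤ (4 * m : ℕ) * r := by
      refine le_trans ?_ havg
      calc S i = ∑ j, w j * S i := by rw [← Finset.sum_mul, hw1, one_mul]
        _ ≤ _ := Finset.sum_le_sum fun j _ => mul_le_mul_of_nonneg_left (hi j (Finset.mem_univ j)) (hw j)
    refine (hausdorffMeasure_frontier_le_sum hP (φ i) hm hα).trans (ENNReal.ofReal_le_ofReal ?_)
    have hα2 : α / 2 = Real.pi / (4 * m : ℕ) := by
      rw [hα]; push_cast; field_simp; norm_num
    have htan : 0 ≤ Real.tan (α / 2) := by
      refine Real.tan_nonneg_of_nonneg_of_le_pi_div_two (by positivity) ?_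
      rw [hα, div_div]
      exact div_le_div_of_nonneg_left Real.pi_pos.le two_pos (by linarith)
    rw [← hα2]
    calc _ ≤ 2 * Real.tan (α / 2) * ((4 * m : ℕ) * r) :=
          mul_le_mul_of_nonneg_left hSi (by positivity)
      _ = _ := by ring
  have ht := ((tendsto_mul_tan_div Real.pi).comp
    (tendsto_id.const_mul_atTop' (show 0 < 4 by norm_num)))
  have ht' := ENNReal.tendsto_ofReal ((ht.const_mul 2).mul_const r)
  exact ge_of_tendsto ht' (eventually_gt_atTop 0 |>.mono key)

/-- A shape without interior is replaced by its `ε`-thickening, which raises the average by at most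
`ε` and whose boundary counts the shape twice; then `ε` tends to `0`. -/
lemma perimeter_le_of_average {P : Set EPlane} (hP : IsConvexShape P) {ι : Type}
    [Fintype ι] {w φ : ι → ℝ} {r : ℝ} (hw : ∀ i, 0 ≤ w i) (hw1 : ∑ i, w i = 1)
    (h : ∀ θ : ℝ, ∑ i, w i * supportFn P (unitDir (φ i + θ)) ≤ r) :
    perimeter P ≤ ENNReal.ofReal (2 * Real.pi * r) := by
  rw [perimeter]
  split_ifs with hint
  · exact hausdorffMeasure_frontier_le_of_average hP hw hw1 h
  · have key : ∀ ε : ℝ, 0 < ε → 2 * Measure.hausdorffMeasure 1 P ≤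
        ENNReal.ofReal (2 * Real.pi * (r + ε)) := by
      intro ε hε
      refine (hP.two_mul_hausdorffMeasure_le hint hε).trans
        (hausdorffMeasure_frontier_le_of_average (hP.cthickening ε) (φ := φ) hw hw1 fun θ => ?_)
      calc _ ≤ ∑ i, w i * (supportFn P (unitDir (φ i + θ)) + ε) :=
            Finset.sum_le_sum fun i _ => mul_le_mul_of_nonneg_left
              (hP.supportFn_cthickening_le hε.le (norm_unitDir _)) (hw i)
        _ = ∑ i, w i * supportFn P (unitDir (φ i + θ)) + ε := by
            simp only [mul_add, Finset.sum_add_distrib, ← Finset.sum_mul, hw1, one_mul]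
        _ ≤ r + ε := by linarith [h θ]
    have ht : Tendsto (fun ε : ℝ => ENNReal.ofReal (2 * Real.pi * (r + ε))) (𝓝[>] 0)
        (𝓝 (ENNReal.ofReal (2 * Real.pi * r))) := by
      have hc : Continuous fun ε : ℝ => ENNReal.ofReal (2 * Real.pi * (r + ε)) :=
        ENNReal.continuous_ofReal.comp (by fun_prop)
      have := hc.tendsto 0
      rw [add_zero] at this
      exact this.mono_left nhdsWithin_le_nhds
    exact ge_of_tendsto ht (eventually_mem_nhdsWithin.mono key)

lemma perimeter_le_of_mem_freelyPlaceable {P Q : Set EPlane} (hQ : IsConvexShape Q)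
    {c : EPlane} {r : ℝ} (hr : 0 ≤ r) (hsub : Metric.closedBall c r ⊆ Q)
    (hmax : ∀ (c' : EPlane) (r' : ℝ), 0 ≤ r' → Metric.closedBall c' r' ⊆ Q → r' ≤ r)
    (hPQ : P ∈ freelyPlaceable Q) : perimeter P ≤ ENNReal.ofReal (2 * Real.pi * r) := by
  obtain ⟨hP, hplace⟩ := hPQ
  obtain ⟨ι, _, w, u, hw, hw1, hu, hsupp, hbal⟩ := hQ.exists_balanced_normals hr hsub hmax
  choose φ hφ using fun i => exists_eq_unitDir (hu i)
  refine perimeter_le_of_average hP (φ := φ) hw hw1 fun θ => ?_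
  -- Rotating `P` by `-θ` and testing in direction `φ i` is the same as testing `P` in direction `φ
  -- i + θ`.
  obtain ⟨t, ht⟩ := hplace (-θ)
  have hle : ∀ i, supportFn P (unitDir (φ i + θ)) ≤ r + inner ℝ (u i) (c - t) := by
    intro i
    refine hP.supportFn_le fun x hx => ?_
    have h1 := hQ.inner_le_supportFn (u i) (ht (mem_image_of_mem _ hx))
    simp only [hsupp, inner_add_right] at h1
    rw [inner_sub_right, real_inner_comm]
    rw [hφ i, real_inner_comm, inner_rotatePlane_unitDir, sub_neg_eq_add] at h1
    rw [hφ i]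
    linarith
  -- The unknown translation `t` enters linearly and disappears because the normals are balanced.
  calc _ ≤ ∑ i, w i * (r + inner ℝ (u i) (c - t)) :=
        Finset.sum_le_sum fun i _ => mul_le_mul_of_nonneg_left (hle i) (hw i)
    _ = r + inner ℝ (∑ i, w i • u i) (c - t) := by
        simp only [mul_add, Finset.sum_add_distrib, ← Finset.sum_mul, hw1, one_mul, sum_inner,
          real_inner_smul_left]
    _ = r := by rw [hbal, inner_zero_left, add_zero]

/-! ### The Reuleaux triangle in the unit square -/

lemma dist_sq_plane (x y : EPlane) : dist x y ^ 2 = (x 0 - y 0) ^ 2 + (x 1 - y 1) ^ 2 := by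
  rw [EuclideanSpace.dist_eq, Real.sq_sqrt (by positivity), Fin.sum_univ_two, Real.dist_eq,
    Real.dist_eq, sq_abs, sq_abs]

lemma mem_closedBall_plane {x y : EPlane} {r : ℝ} (hr : 0 ≤ r) :
    x ∈ Metric.closedBall y r ↔ (x 0 - y 0) ^ 2 + (x 1 - y 1) ^ 2 ≤ r ^ 2 := by
  rw [Metric.mem_closedBall, ← dist_sq_plane, sq_le_sq₀ dist_nonneg hr]

lemma mem_reuleauxTriangle {x : EPlane} : x ∈ reuleauxTriangle ↔
    x 0 ^ 2 + x 1 ^ 2 ≤ 1 ∧ (x 0 - 1) ^ 2 + x 1 ^ 2 ≤ 1 ∧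
      (x 0 - 1 / 2) ^ 2 + (x 1 - √3 / 2) ^ 2 ≤ 1 := by
  simp only [reuleauxTriangle, mem_inter_iff, mem_closedBall_plane zero_le_one, one_pow]
  simp [and_assoc]

lemma isConvexShape_unitSquare : IsConvexShape unitSquare := by
  have hc : ∀ i : Fin 2, Continuous fun x : EPlane => x i := fun i => by fun_prop
  refine ⟨⟨0, by simp [unitSquare]⟩, ?_, ?_⟩
  · refine Metric.isCompact_of_isClosed_isBounded ?_ ?_
    · exact (isClosed_le continuous_const (hc 0)).inter ((isClosed_le (hc 0) continuous_const).inter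
        ((isClosed_le continuous_const (hc 1)).inter (isClosed_le (hc 1) continuous_const)))
    · refine Metric.isBounded_closedBall (x := (0 : EPlane)) (r := 2) |>.subset ?_
      rintro x ⟨h1, h2, h3, h4⟩
      rw [mem_closedBall_plane (by norm_num)]
      simp only [PiLp.zero_apply, sub_zero]
      nlinarith
  · rintro x ⟨h1, h2, h3, h4⟩ y ⟨k1, k2, k3, k4⟩ a b ha hb hab
    simp only [unitSquare, mem_ofPred_eq, PiLp.add_apply, PiLp.smul_apply, smul_eq_mul]
    refine ⟨by positivity, by nlinarith, by positivity, by nlinarith⟩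

lemma isConvexShape_reuleauxTriangle : IsConvexShape reuleauxTriangle := by
  refine ⟨⟨0, ?_⟩, ?_, ?_⟩
  · rw [mem_reuleauxTriangle]
    have := Real.sq_sqrt (show (0 : ℝ) ≤ 3 by norm_num)
    simp only [PiLp.zero_apply]
    refine ⟨by norm_num, by norm_num, by nlinarith⟩
  · exact ((isCompact_closedBall _ _).inter (isCompact_closedBall _ _)).inter
      (isCompact_closedBall _ _)
  · exact ((convex_closedBall _ _).inter (convex_closedBall _ _)).inter (convex_closedBall _ _)

/-- Unit disks centred at `q` and `q'`, both at distance one from `p`, lie on the positive side of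
`p` in every direction of the cone spanned by `q - p` and `q' - p`. -/
lemma inner_sub_le_one_of_cone {x y p q q' u : EPlane} {a b : ℝ} (hu : ‖u‖ = 1)
    (ha : 0 ≤ a) (hb : 0 ≤ b) (huab : u = a • (q - p) + b • (q' - p))
    (hq : dist q p = 1) (hq' : dist q' p = 1) (hx : dist x p ≤ 1)
    (hyq : dist y q ≤ 1) (hyq' : dist y q' ≤ 1) : inner ℝ u (x - y) ≤ 1 := by
  have hcone : ∀ z, dist z p = 1 → dist y z ≤ 1 → 0 ≤ inner ℝ (z - p) (y - p) := by
    intro z hz hyz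
    rw [dist_eq_norm] at hz hyz
    have h1 : ‖y - z‖ ^ 2 ≤ 1 := by nlinarith [norm_nonneg (y - z)]
    rw [show y - z = (y - p) - (z - p) by abel, norm_sub_sq_real, hz, real_inner_comm] at h1
    nlinarith [sq_nonneg ‖y - p‖]
  have h1 : inner ℝ u (x - p) ≤ 1 := by
    refine (real_inner_le_norm u (x - p)).trans ?_
    rwa [hu, one_mul, ← dist_eq_norm]
  have h2 : 0 ≤ inner ℝ u (y - p) := by
    rw [huab, inner_add_left, real_inner_smul_left, real_inner_smul_left]
    have := hcone q hq hyq
    have := hcone q' hq' hyq'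
    positivity
  rw [show x - y = (x - p) - (y - p) by abel, inner_sub_right]
  linarith

/-- The Reuleaux triangle has width at most one in every direction. -/
lemma inner_sub_le_one_of_mem_reuleauxTriangle {x y u : EPlane} (hx : x ∈ reuleauxTriangle)
    (hy : y ∈ reuleauxTriangle) (hu : ‖u‖ = 1) : inner ℝ u (x - y) ≤ 1 := by
  obtain ⟨⟨hxA, hxB⟩, hxC⟩ := hx
  obtain ⟨⟨hyA, hyB⟩, hyC⟩ := hy
  rw [Metric.mem_closedBall] at hxA hxB hxC hyA hyB hyC
  have h3 : √3 ^ 2 = 3 := Real.sq_sqrt (by norm_num)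
  have h30 : 0 < √3 := by positivity
  have hdist : ∀ z z' : EPlane, (z 0 - z' 0) ^ 2 + (z 1 - z' 1) ^ 2 = 1 → dist z z' = 1 := by
    intro z z' h
    rw [← dist_sq_plane] at h
    nlinarith [dist_nonneg (x := z) (y := z')]
  set A : EPlane := !₂[0, 0] with hA
  set B : EPlane := !₂[1, 0] with hB
  set C : EPlane := !₂[1 / 2, √3 / 2] with hC
  have hAB : dist A B = 1 := hdist _ _ (by simp [hA, hB])
  have hAC : dist A C = 1 := hdist _ _ (by simp [hA, hC, div_pow, h3]; norm_num)
  have hBC : dist B C = 1 := hdist _ _ (by simp [hB, hC, div_pow, h3]; norm_num)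
  have hBA := (dist_comm B A).trans hAB
  have hCA := (dist_comm C A).trans hAC
  have hCB := (dist_comm C B).trans hBC
  obtain ⟨a, b, huab⟩ : ∃ a b : ℝ, u = a • (B - A) + b • (C - A) := by
    refine ⟨u 0 - u 1 / √3, 2 * u 1 / √3, ?_⟩
    ext i
    fin_cases i
    · simp [hA, hB, hC]; ring
    · simp [hA, hB, hC]; field_simp
  have hun : ‖-u‖ = 1 := by rwa [norm_neg]
  have hneg : inner ℝ (-u) (y - x) ≤ 1 → inner ℝ u (x - y) ≤ 1 := fun h => by
    rwa [inner_neg_left, ← inner_neg_right, neg_sub] at h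
  -- The signs of `a`, `b` and `a + b` split the plane into six sectors. Each is the cone spanned at
  -- one vertex by the two sides there, or the negative of such a cone.
  rcases le_total 0 a with ha | ha <;> rcases le_total 0 b with hb | hb
  · exact inner_sub_le_one_of_cone hu ha hb huab hBA hCA hxA hyB hyC
  · rcases le_total 0 (a + b) with hab | hab
    · exact hneg (inner_sub_le_one_of_cone (p := B) (q := A) (q' := C) (a := a + b) (b := -b) hun hab
        (by linarith) (by rw [huab]; module) hAB hCB hyB hxA hxC)
    · exact inner_sub_le_one_of_cone (p := C) (q := A) (q' := B) (a := -(a + b)) (b := a) hu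
        (by linarith) ha (by rw [huab]; module) hAC hBC hxC hyA hyB
  · rcases le_total 0 (a + b) with hab | hab
    · exact hneg (inner_sub_le_one_of_cone (p := C) (q := A) (q' := B) (a := a + b) (b := -a) hun hab
        (by linarith) (by rw [huab]; module) hAC hBC hyC hxA hxB)
    · exact inner_sub_le_one_of_cone (p := B) (q := A) (q' := C) (a := -(a + b)) (b := b) hu
        (by linarith) hb (by rw [huab]; module) hAB hCB hxB hyA hyC
  · exact hneg (inner_sub_le_one_of_cone (a := -a) (b := -b) hun (by linarith) (by linarith)
      (by rw [huab]; module) hBA hCA hyA hxB hxC)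

/-- The coordinates of a rotated copy are inner products with unit vectors, hence vary by at most
`1`; the translation moves both minima to `0`. -/
lemma reuleauxTriangle_mem_freelyPlaceable : reuleauxTriangle ∈ freelyPlaceable unitSquare := by
  have hR := isConvexShape_reuleauxTriangle
  refine ⟨hR, fun θ => ?_⟩
  have hc0 : ∀ x, rotatePlane θ x 0 = inner ℝ (unitDir (-θ)) x := fun x => by
    simp [rotatePlane, inner_plane]
    ring
  have hc1 : ∀ x, rotatePlane θ x 1 = inner ℝ (unitDir (Real.pi / 2 - θ)) x := fun x => by
    simp [rotatePlane, inner_plane, Real.cos_pi_div_two_sub, Real.sin_pi_div_two_sub]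
  have hmin : ∀ u : EPlane, ∃ y ∈ reuleauxTriangle, ∀ x ∈ reuleauxTriangle,
      inner ℝ u y ≤ inner ℝ u x := fun u => by
    obtain ⟨y, hy, h⟩ := hR.isCompact.exists_isMinOn hR.nonempty
      (show Continuous fun x : EPlane => inner ℝ u x by fun_prop).continuousOn
    exact ⟨y, hy, isMinOn_iff.1 h⟩
  obtain ⟨y, hy, hy'⟩ := hmin (unitDir (-θ))
  obtain ⟨z, hz, hz'⟩ := hmin (unitDir (Real.pi / 2 - θ))
  refine ⟨!₂[-inner ℝ (unitDir (-θ)) y, -inner ℝ (unitDir (Real.pi / 2 - θ)) z], ?_⟩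
  rintro _ ⟨x, hx, rfl⟩
  have h1 := inner_sub_le_one_of_mem_reuleauxTriangle hx hy (norm_unitDir (-θ))
  have h2 := inner_sub_le_one_of_mem_reuleauxTriangle hx hz (norm_unitDir (Real.pi / 2 - θ))
  rw [inner_sub_right] at h1 h2
  have h3 := hy' x hx
  have h4 := hz' x hx
  simp only [unitSquare, mem_ofPred_eq, PiLp.add_apply, hc0, hc1,
    Matrix.cons_val_zero, Matrix.cons_val_one]
  refine ⟨?_, ?_, ?_, ?_⟩ <;> linarith

lemma not_isDisk_reuleauxTriangle : ¬ IsDisk reuleauxTriangle := by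
  rintro ⟨c, r, hr, h⟩
  have h3 : √3 ^ 2 = 3 := Real.sq_sqrt (by norm_num)
  have hmem : ∀ x : EPlane, x ∈ reuleauxTriangle → (x 0 - c 0) ^ 2 + (x 1 - c 1) ^ 2 ≤ r ^ 2 :=
    fun x hx => (mem_closedBall_plane hr).1 (h ▸ hx)
  have hA := hmem !₂[0, 0] (by
    rw [mem_reuleauxTriangle]; simp [div_pow, h3]; norm_num)
  have hB := hmem !₂[1, 0] (by
    rw [mem_reuleauxTriangle]; simp [div_pow, h3]; norm_num)
  have hC := hmem !₂[1 / 2, √3 / 2] (by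
    rw [mem_reuleauxTriangle]; simp [div_pow, h3]; norm_num)
  have hu : ‖unitDir 0‖ = 1 := norm_unitDir 0
  have hball : ∀ s : ℝ, |s| = r → c + s • unitDir 0 ∈ reuleauxTriangle := fun s hs => by
    rw [h]; simp [norm_smul, hu, hs]
  have hw := inner_sub_le_one_of_mem_reuleauxTriangle (hball r (abs_of_nonneg hr))
    (hball (-r) (by rw [abs_neg, abs_of_nonneg hr])) hu
  rw [add_sub_add_left_eq_sub, ← sub_smul, real_inner_smul_right, real_inner_self_eq_norm_sq,
    hu] at hw
  simp only [Matrix.cons_val_zero, Matrix.cons_val_one] at hA hB hC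
  -- The width bound gives `2 * r ≤ 1`. But the squared distances from `c` to the three vertices sum
  -- to at least `1`, with equality at the centroid `(1/2, √3/6)`, and would be at most `3 * r ^ 2 ≤
  -- 3/4`.
  nlinarith [sq_nonneg (c 0 - 1 / 2), sq_nonneg (c 1 - √3 / 6)]

/-! ### Perimeter of the Reuleaux triangle -/

/-- On the unit circle about `p`, the points at distance `1` from the starting point lie at angles
`±π/3` from it, and the half-open arc omits its endpoint. This separates the three arcs of the
Reuleaux triangle. -/
lemma disjoint_circleArc_sphere (p : EPlane) (a : ℝ) :
    Disjoint (circleArc p 1 a (a + Real.pi / 3)) (Metric.sphere (p + unitDir a) 1) := by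
  rw [Set.disjoint_left]
  rintro _ ⟨θ, ⟨h1, h2⟩, rfl⟩ h
  have h' : ‖unitDir θ - unitDir a‖ = 1 := by
    rw [mem_sphere_iff_norm] at h
    simpa using h
  have h3 : ‖unitDir θ - unitDir a‖ ^ 2 = 1 := by rw [h', one_pow]
  rw [norm_sub_sq_real, inner_unitDir_unitDir, norm_unitDir, norm_unitDir] at h3
  have h4 : Real.cos (Real.pi / 3) < Real.cos (θ - a) :=
    Real.cos_lt_cos_of_nonneg_of_le_pi (by linarith) (by linarith [Real.pi_pos]) (by linarith)
  rw [Real.cos_pi_div_three] at h4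
  linarith

lemma circleArc_subset (p : EPlane) (a : ℝ) :
    circleArc p 1 a (a + Real.pi / 3) ⊆ Metric.sphere p 1 ∩
      (Metric.closedBall (p + unitDir a) 1 ∩ Metric.closedBall (p + unitDir (a + Real.pi / 3)) 1) := by
  rintro _ ⟨θ, ⟨h1, h2⟩, rfl⟩
  have key : ∀ b, |θ - b| ≤ Real.pi / 3 →
      p + (1 : ℝ) • unitDir θ ∈ Metric.closedBall (p + unitDir b) 1 := by
    intro b hb
    have h3 : ‖unitDir θ - unitDir b‖ ^ 2 ≤ 1 := by
      rw [norm_sub_sq_real, inner_unitDir_unitDir, norm_unitDir, norm_unitDir]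
      have h4 : Real.cos (Real.pi / 3) ≤ Real.cos |θ - b| :=
        Real.cos_le_cos_of_nonneg_of_le_pi (abs_nonneg _) (by linarith [Real.pi_pos]) hb
      rw [Real.cos_abs, Real.cos_pi_div_three] at h4
      linarith
    rw [mem_closedBall_iff_norm, one_smul, add_sub_add_left_eq_sub]
    nlinarith [norm_nonneg (unitDir θ - unitDir b)]
  refine ⟨by simp [norm_unitDir], key _ ?_, key _ ?_⟩ <;> rw [abs_le] <;> constructor <;> linarith

lemma le_perimeter_reuleauxTriangle : ENNReal.ofReal Real.pi ≤ perimeter reuleauxTriangle := by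
  have h3 : √3 ^ 2 = 3 := Real.sq_sqrt (by norm_num)
  have h30 : 0 < √3 := by positivity
  have hint : (interior reuleauxTriangle).Nonempty := by
    refine ⟨!₂[1 / 2, √3 / 6], ?_⟩
    have hball : ∀ c : EPlane, ((1 / 2 : ℝ) - c 0) ^ 2 + (√3 / 6 - c 1) ^ 2 < 1 →
        (!₂[1 / 2, √3 / 6] : EPlane) ∈ interior (Metric.closedBall c 1) := by
      intro c hc
      rw [interior_closedBall _ one_ne_zero, Metric.mem_ball]
      have : dist (!₂[1 / 2, √3 / 6] : EPlane) c ^ 2 < 1 := by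
        rw [dist_sq_plane]
        exact hc
      nlinarith [dist_nonneg (x := (!₂[1 / 2, √3 / 6] : EPlane)) (y := c)]
    rw [reuleauxTriangle, interior_inter, interior_inter]
    refine ⟨⟨hball _ ?_, hball _ ?_⟩, hball _ ?_⟩ <;>
      simp only [Matrix.cons_val_zero, Matrix.cons_val_one] <;> nlinarith
  rw [perimeter, if_pos hint]
  set A : EPlane := !₂[0, 0] with hA
  set B : EPlane := !₂[1, 0] with hB
  set C : EPlane := !₂[1 / 2, √3 / 2] with hC
  have c1 : Real.cos (Real.pi / 3) = 1 / 2 := Real.cos_pi_div_three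
  have s1 : Real.sin (Real.pi / 3) = √3 / 2 := Real.sin_pi_div_three
  have e1 : A + unitDir 0 = B := by ext i; fin_cases i <;> simp [hA, hB]
  have e2 : A + unitDir (0 + Real.pi / 3) = C := by
    ext i; fin_cases i <;> simp [hA, hC]
  have a2 : 2 * Real.pi / 3 = Real.pi - Real.pi / 3 := by ring
  have a4 : 4 * Real.pi / 3 = Real.pi / 3 + Real.pi := by ring
  have a5 : 4 * Real.pi / 3 + Real.pi / 3 = 2 * Real.pi - Real.pi / 3 := by ring
  have e3 : B + unitDir (2 * Real.pi / 3) = C := by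
    ext i; fin_cases i
    · simp [hB, hC, a2]; norm_num
    · simp [hB, hC, a2]
  have e4 : B + unitDir (2 * Real.pi / 3 + Real.pi / 3) = A := by
    rw [show 2 * Real.pi / 3 + Real.pi / 3 = Real.pi by ring]
    ext i; fin_cases i <;> simp [hA, hB]
  have e5 : C + unitDir (4 * Real.pi / 3) = A := by
    ext i; fin_cases i
    · simp [hA, hC, a4]
    · simp [hA, hC, a4]
  have e6 : C + unitDir (4 * Real.pi / 3 + Real.pi / 3) = B := by
    rw [a5]
    ext i; fin_cases i
    · simp [hB, hC, Real.cos_two_pi_sub]; norm_num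
    · simp [hB, hC, Real.sin_two_pi_sub]
  set α := circleArc A 1 0 (0 + Real.pi / 3) with hα
  set β := circleArc B 1 (2 * Real.pi / 3) (2 * Real.pi / 3 + Real.pi / 3) with hβ
  set γ := circleArc C 1 (4 * Real.pi / 3) (4 * Real.pi / 3 + Real.pi / 3) with hγ
  have sα := circleArc_subset A 0
  have sβ := circleArc_subset B (2 * Real.pi / 3)
  have sγ := circleArc_subset C (4 * Real.pi / 3)
  rw [e1, e2, ← hα] at sα
  rw [e3, e4, ← hβ] at sβ
  rw [e5, e6, ← hγ] at sγ
  have dα := disjoint_circleArc_sphere A 0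
  have dβ := disjoint_circleArc_sphere B (2 * Real.pi / 3)
  have dγ := disjoint_circleArc_sphere C (4 * Real.pi / 3)
  rw [e1, ← hα] at dα
  rw [e3, ← hβ] at dβ
  rw [e5, ← hγ] at dγ
  have hfr : ∀ (p : EPlane) (x : EPlane), reuleauxTriangle ⊆ Metric.closedBall p 1 →
      x ∈ reuleauxTriangle → x ∈ Metric.sphere p 1 → x ∈ frontier reuleauxTriangle := by
    intro p x hp hx hxp
    refine ⟨subset_closure hx, fun hxi => ?_⟩
    have := interior_mono hp hxi
    rw [interior_closedBall _ one_ne_zero, Metric.mem_ball] at this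
    exact this.ne hxp
  have hsub : α ∪ (β ∪ γ) ⊆ frontier reuleauxTriangle := by
    rintro x (hx | hx | hx)
    · obtain ⟨h1, h2, h3⟩ := sα hx
      exact hfr A x (fun y hy => hy.1.1) ⟨⟨Metric.sphere_subset_closedBall h1, h2⟩, h3⟩ h1
    · obtain ⟨h1, h2, h3⟩ := sβ hx
      exact hfr B x (fun y hy => hy.1.2) ⟨⟨h3, Metric.sphere_subset_closedBall h1⟩, h2⟩ h1
    · obtain ⟨h1, h2, h3⟩ := sγ hx
      exact hfr C x (fun y hy => hy.2) ⟨⟨h2, h3⟩, Metric.sphere_subset_closedBall h1⟩ h1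
  -- Cyclic pattern: each arc avoids the unit circle about its own starting vertex, and that circle
  -- contains another of the arcs.
  have hβγ : Disjoint β γ := dβ.mono_right fun x hx => (sγ hx).1
  have hαβ : Disjoint α β := dα.mono_right fun x hx => (sβ hx).1
  have hαγ : Disjoint α γ := (dγ.mono_right fun x hx => (sα hx).1).symm
  have hmeas : ∀ (p : EPlane) (a : ℝ), MeasurableSet (circleArc p 1 a (a + Real.pi / 3)) :=
    fun p a => measurableSet_circleArc p one_pos (by linarith [Real.pi_pos])
  have hlen : ∀ (p : EPlane) (a : ℝ), ENNReal.ofReal (Real.pi / 3) ≤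
      Measure.hausdorffMeasure 1 (circleArc p 1 a (a + Real.pi / 3)) := fun p a => by
    have := le_hausdorffMeasure_circleArc p one_pos (a := a) (b := a + Real.pi / 3)
      (by linarith [Real.pi_pos]) (by linarith [Real.pi_pos])
    rwa [add_sub_cancel_left, one_mul] at this
  refine le_trans ?_ (measure_mono hsub)
  rw [measure_union (disjoint_union_right.2 ⟨hαβ, hαγ⟩) ((hmeas _ _).union (hmeas _ _)),
    measure_union hβγ (hmeas _ _)]
  refine le_trans (le_of_eq ?_) (add_le_add (hlen _ _) (add_le_add (hlen _ _) (hlen _ _)))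
  have hp : 0 ≤ Real.pi / 3 := by positivity
  rw [← ENNReal.ofReal_add hp hp, ← ENNReal.ofReal_add hp (by positivity)]
  congr 1
  ring

/-! ### Disks in the square and conclusion -/

lemma radius_le_of_closedBall_subset_unitSquare {c : EPlane} {r : ℝ} (hr : 0 ≤ r)
    (h : Metric.closedBall c r ⊆ unitSquare) : r ≤ 1 / 2 := by
  have hball : ∀ s : ℝ, |s| = r → c + s • unitDir 0 ∈ unitSquare := fun s hs =>
    h (by simp [norm_smul, norm_unitDir, hs])
  have h1 := (hball r (abs_of_nonneg hr)).2.1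
  have h2 := (hball (-r) (by rw [abs_neg, abs_of_nonneg hr])).1
  simp only [PiLp.add_apply, PiLp.smul_apply, unitDir_zero_coord, Real.cos_zero, smul_eq_mul] at h1 h2
  linarith

lemma IsLargestInscribedDisk.perimeter_le {D Q : Set EPlane} (hD : IsLargestInscribedDisk D Q)
    (hQ : IsConvexShape Q) {P : Set EPlane} (hP : P ∈ freelyPlaceable Q) :
    perimeter P ≤ perimeter D := by
  obtain ⟨c, r, hr, rfl, hsub, hmax⟩ := hD
  exact (perimeter_le_of_mem_freelyPlaceable hQ hr hsub hmax hP).trans (le_perimeter_closedBall c hr)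

lemma perimeter_closedBall_le (c : EPlane) {r : ℝ} (hr : 0 ≤ r) :
    perimeter (Metric.closedBall c r) ≤ ENNReal.ofReal (2 * Real.pi * r) := by
  have hB : IsConvexShape (Metric.closedBall c r) :=
    ⟨⟨c, Metric.mem_closedBall_self hr⟩, isCompact_closedBall c r, convex_closedBall c r⟩
  -- Two opposite directions with equal weights are balanced, and the average of the support
  -- function over them is half the width, at most `r`.
  refine perimeter_le_of_average hB (ι := Fin 2) (w := fun _ => 1 / 2)
    (φ := fun i => i * Real.pi) (fun _ => by norm_num) (by simp) fun θ => ?_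
  have hle : ∀ u : EPlane, ‖u‖ = 1 → supportFn (Metric.closedBall c r) u ≤ inner ℝ u c + r := by
    intro u hu
    refine hB.supportFn_le fun x hx => ?_
    have := (real_inner_le_norm u (x - c))
    rw [hu, one_mul, ← dist_eq_norm, inner_sub_right] at this
    linarith [Metric.mem_closedBall.1 hx]
  have h0 := hle _ (norm_unitDir θ)
  have h1 := hle _ (norm_unitDir (Real.pi + θ))
  have e : unitDir (Real.pi + θ) = -unitDir θ := by
    ext i; fin_cases i <;> simp [add_comm Real.pi]
  rw [e, inner_neg_left] at h1
  simp [Fin.sum_univ_two, e]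
  linarith

theorem theorem3 :
    (∀ Q : Set EPlane, IsConvexShape Q →
      (∃ D : Set EPlane, IsLargestInscribedDisk D Q) ∧
      ∀ D : Set EPlane, IsLargestInscribedDisk D Q →
        ∀ P ∈ freelyPlaceable Q, perimeter P ≤ perimeter D) ∧
    (IsConvexShape unitSquare ∧ reuleauxTriangle ∈ freelyPlaceable unitSquare ∧
      ¬ IsDisk reuleauxTriangle ∧
      ∀ D : Set EPlane, IsLargestInscribedDisk D unitSquare →
        perimeter reuleauxTriangle = perimeter D) := by
  refine ⟨fun Q hQ => ⟨hQ.exists_isLargestInscribedDisk, fun D hD P hP => hD.perimeter_le hQ hP⟩,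
    isConvexShape_unitSquare, reuleauxTriangle_mem_freelyPlaceable, not_isDisk_reuleauxTriangle,
    fun D hD => le_antisymm
      (hD.perimeter_le isConvexShape_unitSquare reuleauxTriangle_mem_freelyPlaceable) ?_⟩
  obtain ⟨c, r, hr, rfl, hsub, -⟩ := hD
  -- Any disk in the square has radius at most `1/2`, so its perimeter is at most `π`, a lower bound
  -- for that of the Reuleaux triangle. Maximality of the disk is needed only for the opposite
  -- inequality.
  refine (perimeter_closedBall_le c hr).trans (le_trans (ENNReal.ofReal_le_ofReal ?_)
    le_perimeter_reuleauxTriangle)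
  have := radius_le_of_closedBall_subset_unitSquare hr hsub
  nlinarith [Real.pi_pos]
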